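/- **Definitions.** A Hadamard matrix is a square matrix with entries $\pm1$ whose rows are mutually orthogonal. Two Hadamard matrices are H-equivalent (Hadamard equivalent) if one is obtained from the other by a sequence of row negations, column negations, row permutations and column permutations. Four distinct rows $h_i,h_j,h_k,h_\ell$ of a Hadamard matrix $H$ form a *closed quadruple* if their entrywise product is the all $1$ vector or the all $-1$ vector. To *switch* it, partition the columns into four fields: after negating every column in which the product of the entries in rows $i,j,k$ is $-1$, a column belongs to the first, second, third or fourth field according as its entries in rows $i,j,k$ are $(1,1,1)$, $(-1,-1,1)$, $(-1,1,-1)$ or $(1,-1,-1)$; then choose one field and negate all the entries of $H$ that lie in the rows $i,j,k,\ell$ and in the columns of that field. Switching a closed quadruple of columns is defined by transposition. Two Hadamard matrices of the same order $n\equiv 0\pmod 8$ are *Q-equivalent* if one is obtained from the other by a sequence of row or column negations, row or column permutations, and switchings of closed quadruples of rows or of columns. The classes of these relations are called H-classes and Q-classes. **Proposition.** All Hadamard matrices of order $32$ of either of the forms $$\begin{bmatrix}A & B\\ A & -B\end{bmatrix},\qquad \begin{bmatrix}A & A\\ B & -B\end{bmatrix},$$ where $A$ and $B$ are any Hadamard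 matrices of order $16$, are Q-equivalent: any two such matrices, of the same form or of different forms and with arbitrary choices of $A$ and $B$, are Q-equivalent. Consequently every H-class that contains a matrix of one of these forms is contained in one single Q-class, namely the Q-class of the Sylvester Hadamard matrix of order $32$ (where the Sylvester matrices are $S_1=[1]$ and $S_{2m}=\begin{bmatrix}S_m&S_m\\S_m&-S_m\end{bmatrix}$). -/

import Mathlib

/-- Negation of row `r`. -/
def negRow {n : ℕ} (H : Matrix (Fin n) (Fin n) ℤ) (r : Fin n) : Matrix (Fin n) (Fin n) ℤ :=
  Matrix.of fun i c => if i = r then -H i c else H i c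

/-- The rows `q 0, q 1, q 2, q 3` are four distinct rows of `H` whose entrywise product is the
all `1` vector or the all `-1` vector. -/
def IsClosedQuadruple {n : ℕ} (H : Matrix (Fin n) (Fin n) ℤ) (q : Fin 4 → Fin n) : Prop :=
  Function.Injective q ∧
    ((∀ c, H (q 0) c * H (q 1) c * H (q 2) c * H (q 3) c = 1) ∨
      ∀ c, H (q 0) c * H (q 1) c * H (q 2) c * H (q 3) c = -1)

/-- The 3-normalization of a `±1` matrix on the rows `q 0, q 1, q 2`: those columns are negated in
which the product of the entries in these three rows is `-1`. -/
def threeNormalize {n : ℕ} (H : Matrix (Fin n) (Fin n) ℤ) (q : Fin 4 → Fin n) :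
    Matrix (Fin n) (Fin n) ℤ :=
  Matrix.of fun r c => H (q 0) c * H (q 1) c * H (q 2) c * H r c

/-- The entries of a 3-normalized matrix in the three normalizing rows, in the columns of each of
the four fields. -/
def fieldPattern : Fin 4 → Fin 3 → ℤ :=
  ![![1, 1, 1], ![-1, -1, 1], ![-1, 1, -1], ![1, -1, -1]]

/-- The column `c` lies in the field number `t` of the partition of the columns into four fields
that is induced by 3-normalization on the quadruple of rows `q`. -/
abbrev InField {n : ℕ} (H : Matrix (Fin n) (Fin n) ℤ) (q : Fin 4 → Fin n) (t : Fin 4)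
    (c : Fin n) : Prop :=
  ∀ s : Fin 3, threeNormalize H q (q s.castSucc) c = fieldPattern t s

/-- Switching: the entries that lie in a row of the quadruple `q` and in a column of the field
number `t` are negated. -/
def switchRows {n : ℕ} (H : Matrix (Fin n) (Fin n) ℤ) (q : Fin 4 → Fin n) (t : Fin 4) :
    Matrix (Fin n) (Fin n) ℤ :=
  Matrix.of fun r c => if (∃ s, q s = r) ∧ InField H q t c then -H r c else H r c

/-- The elementary operations of Hadamard equivalence. -/
inductive HStep {n : ℕ} :
    Matrix (Fin n) (Fin n) ℤ → Matrix (Fin n) (Fin n) ℤ → Prop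
  | negateRow (H : Matrix (Fin n) (Fin n) ℤ) (r : Fin n) : HStep H (negRow H r)
  | negateCol (H : Matrix (Fin n) (Fin n) ℤ) (c : Fin n) :
      HStep H (negRow H.transpose c).transpose
  | permuteRows (H : Matrix (Fin n) (Fin n) ℤ) (σ : Equiv.Perm (Fin n)) :
      HStep H (H.submatrix σ id)
  | permuteCols (H : Matrix (Fin n) (Fin n) ℤ) (σ : Equiv.Perm (Fin n)) :
      HStep H (H.submatrix id σ)

/-- The elementary operations of Q-equivalence in orders divisible by `8`. -/
inductive QStep {n : ℕ} :
    Matrix (Fin n) (Fin n) ℤ → Matrix (Fin n) (Fin n) ℤ → Prop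
  | hadamard (H K : Matrix (Fin n) (Fin n) ℤ) (h : HStep H K) : QStep H K
  | switchRowQuadruple (H : Matrix (Fin n) (Fin n) ℤ) (q : Fin 4 → Fin n) (t : Fin 4)
      (h : IsClosedQuadruple H q) : QStep H (switchRows H q t)
  | switchColQuadruple (H : Matrix (Fin n) (Fin n) ℤ) (q : Fin 4 → Fin n) (t : Fin 4)
      (h : IsClosedQuadruple H.transpose q) :
      QStep H (switchRows H.transpose q t).transpose

/-- Hadamard equivalence of Hadamard matrices. -/
def HEquiv {n : ℕ} (H K : Matrix (Fin n) (Fin n) ℤ) : Prop :=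
  H.IsHadamard ∧ K.IsHadamard ∧ Relation.ReflTransGen HStep H K

/-- Q-equivalence of Hadamard matrices whose order is divisible by `8`. -/
def QEquiv {n : ℕ} (H K : Matrix (Fin n) (Fin n) ℤ) : Prop :=
  H.IsHadamard ∧ K.IsHadamard ∧ Relation.ReflTransGen QStep H K

/-- The H-class of a Hadamard matrix. -/
def HClass {n : ℕ} (H : Matrix (Fin n) (Fin n) ℤ) : Set (Matrix (Fin n) (Fin n) ℤ) :=
  {K | HEquiv H K}

/-- The Q-class of a Hadamard matrix whose order is divisible by `8`. -/
def QClass {n : ℕ} (H : Matrix (Fin n) (Fin n) ℤ) : Set (Matrix (Fin n) (Fin n) ℤ) :=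
  {K | QEquiv H K}

/-- The matrix of order `n + n` with the blocks `[[A, B], [C, D]]`. -/
def block {n : ℕ} (A B C D : Matrix (Fin n) (Fin n) ℤ) :
    Matrix (Fin (n + n)) (Fin (n + n)) ℤ :=
  Matrix.reindex finSumFinEquiv finSumFinEquiv (Matrix.fromBlocks A B C D)

/-- The Hadamard matrices of order `2 n` of one of the forms `[[A, B], [A, -B]]` and
`[[A, A], [B, -B]]`, where `A` and `B` are Hadamard matrices of order `n`. -/
def doubledHadamard (n : ℕ) : Set (Matrix (Fin (n + n)) (Fin (n + n)) ℤ) :=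
  {H | ∃ A B : Matrix (Fin n) (Fin n) ℤ, A.IsHadamard ∧ B.IsHadamard ∧
    (H = block A B A (-B) ∨ H = block A A B (-B))}

/-- The Sylvester Hadamard matrix of order `2 ^ k`. -/
def sylvester : (k : ℕ) → Matrix (Fin (2 ^ k)) (Fin (2 ^ k)) ℤ
  | 0 => 1
  | k + 1 =>
    Matrix.reindex (finCongr (by ring)) (finCongr (by ring))
      (block (sylvester k) (sylvester k) (sylvester k) (-sylvester k))

/-!
The doubled matrix `block A A B (-B)` gives independent access to its two halves. Row operations on
`A`, including switchings of closed quadruples of rows, are operations of the same kind on the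
doubled matrix (`block_switchRows`). Negating the column `p` of `A` alone amounts to negating the
columns `p` in both halves and then interchanging them. The columns `p` and `p'` of `A` alone are
interchanged by one column switching: the columns `p` and `p'` of both halves form a closed
quadruple, and one of its fields consists of the rows of `A` in which these columns differ
(`qStep_block_swapCols`). Finally `A` and `B` can be interchanged. So it suffices to transform every
Hadamard matrix of order 16 into the Sylvester matrix by Hadamard equivalence and switchings of
*rows*; the form `block A B A (-B)` is dealt with by transposition.

For a Hadamard matrix of order 16 with rows `h r`, let `w` be a `±1` vector whose inner products
with all rows are divisible by `8`, say `⟨w, h r⟩ = 8 m r`. Then `∑ (m r) ^ 2 = 4` and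
`2 w = ∑ (m r) (h r)`. Hence either `w` is a row up to sign, or `2 w` is a signed sum of four rows.
In the second case exactly one of the four signed entries in each column is `-w`; so the four rows form
a closed quadruple, its fields are told apart by the position of that entry, and switching the first
field turns the first row into `±w`. Rows orthogonal to `w` do not change
(`exists_rowSwitch_row_eq`).

The divisibility holds for the entrywise product of any three different rows
(`Matrix.IsHadamard.eight_dvd_inner`). After normalizing the row `0` to the all `1` vector, the rows
`k = 3, 5, 6, 7, 9, …, 15` can therefore be replaced in turn by the product of two earlier rows,
namely those that belong to the leading binary digit of `k` and to the remaining digits, without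
affecting the rows below `k` (`IsWalshBelow.exists_succ`). At the end each row is the product of
the rows `1`, `2`, `4`, `8` that its binary expansion prescribes, which determines the matrix up
to a permutation of the columns (`IsWalshBelow.exists_permuteCols`).
-/

open Matrix Relation

/-! ### Entries and rows of integer Hadamard matrices -/

theorem mem_unitary_int_iff (a : ℤ) : a ∈ unitary ℤ ↔ a = 1 ∨ a = -1 := by
  rw [Unitary.mem_iff, star_trivial, and_self, mul_self_eq_one_iff]

/-- For integer matrices, the Hadamard property only concerns the entries and the rows. -/
theorem isHadamard_iff_rows {n : ℕ} [NeZero n] (H : Matrix (Fin n) (Fin n) ℤ) :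
    H.IsHadamard ↔ (∀ i j, H i j = 1 ∨ H i j = -1) ∧
      ∀ i j, ∑ c, H i c * H j c = if i = j then (n : ℤ) else 0 := by
  have key : H * Hᴴ = (Fintype.card (Fin n) : ℤ) • (1 : Matrix (Fin n) (Fin n) ℤ) ↔
      ∀ i j, ∑ c, H i c * H j c = if i = j then (n : ℤ) else 0 := by
    rw [← Matrix.ext_iff]
    refine forall₂_congr fun i j => ?_
    simp [Matrix.mul_apply, Matrix.one_apply]
  constructor
  · intro h
    exact ⟨fun i j => (mem_unitary_int_iff _).1 (h.apply_mem i j), key.1 h.mul_conjTranspose⟩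
  · rintro ⟨h1, h2⟩
    refine IsHadamard.of_mul_conjTranspose (fun i j => (mem_unitary_int_iff _).2 (h1 i j))
      (key.2 h2) ?_
    rw [Fintype.card_fin]
    exact IsRegular.of_ne_zero (by exact_mod_cast NeZero.ne n)

namespace Matrix.IsHadamard

variable {n : ℕ} {H : Matrix (Fin n) (Fin n) ℤ}

theorem entry (h : H.IsHadamard) (i j : Fin n) : H i j = 1 ∨ H i j = -1 :=
  (mem_unitary_int_iff _).1 (h.apply_mem i j)

theorem entry_mul_self (h : H.IsHadamard) (i j : Fin n) : H i j * H i j = 1 := by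
  rcases h.entry i j with h | h <;> simp [h]

theorem row_orthogonal (h : H.IsHadamard) {i j : Fin n} (hij : i ≠ j) :
    ∑ c, H i c * H j c = 0 := by
  have := congrFun (congrFun h.mul_conjTranspose i) j
  simpa [Matrix.mul_apply, Matrix.one_apply, hij] using this

theorem col_inner (h : H.IsHadamard) (c d : Fin n) :
    ∑ r, H r c * H r d = if c = d then (n : ℤ) else 0 := by
  have := congrFun (congrFun h.conjTranspose_mul c) d
  simpa [Matrix.mul_apply, Matrix.one_apply] using this

end Matrix.IsHadamard

/-! ### Equivalence by row switchings -/

/-- The elementary operations of Hadamard equivalence together with the switchings of closed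
quadruples of rows, but without switchings of columns. -/
inductive RowSwitchStep {n : ℕ} :
    Matrix (Fin n) (Fin n) ℤ → Matrix (Fin n) (Fin n) ℤ → Prop
  | hadamard (H K : Matrix (Fin n) (Fin n) ℤ) (h : HStep H K) : RowSwitchStep H K
  | switchRowQuadruple (H : Matrix (Fin n) (Fin n) ℤ) (q : Fin 4 → Fin n) (t : Fin 4)
      (h : IsClosedQuadruple H q) : RowSwitchStep H (switchRows H q t)

section Symmetry

variable {n : ℕ} {H K : Matrix (Fin n) (Fin n) ℤ}

theorem negRow_negRow (H : Matrix (Fin n) (Fin n) ℤ) (r : Fin n) :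
    negRow (negRow H r) r = H := by
  ext i c
  by_cases h : i = r <;> simp [negRow, h]

theorem HStep.symm (h : HStep H K) : HStep K H := by
  cases h with
  | negateRow r => simpa only [negRow_negRow] using HStep.negateRow (negRow H r) r
  | negateCol c =>
    simpa only [transpose_transpose, negRow_negRow] using
      HStep.negateCol (negRow H.transpose c).transpose c
  | permuteRows σ =>
    simpa [Matrix.submatrix_submatrix] using HStep.permuteRows (H.submatrix σ id) σ.symm
  | permuteCols σ =>
    simpa [Matrix.submatrix_submatrix] using HStep.permuteCols (H.submatrix id σ) σ.symm

theorem HStep.transpose (h : HStep H K) : HStep Hᵀ Kᵀ := by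
  cases h with
  | negateRow r => exact HStep.negateCol Hᵀ r
  | negateCol c => exact HStep.negateRow Hᵀ c
  | permuteRows σ => exact HStep.permuteCols Hᵀ σ
  | permuteCols σ => exact HStep.permuteRows Hᵀ σ

section Switching

variable {q : Fin 4 → Fin n} {t : Fin 4} {c : Fin n}

theorem switchRows_of_inField (h : InField H q t c) (s : Fin 4) :
    switchRows H q t (q s) c = -H (q s) c :=
  if_pos ⟨⟨s, rfl⟩, h⟩

theorem switchRows_of_not_inField (h : ¬InField H q t c) (r : Fin n) :
    switchRows H q t r c = H r c :=
  if_neg fun h' => h h'.2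

theorem switchRows_of_not_mem {r : Fin n} (h : ∀ s, q s ≠ r) (c : Fin n) :
    switchRows H q t r c = H r c :=
  if_neg fun h' => h'.1.elim h

end Switching

/-- Switching does not affect the four fields: an entry of the normalized matrix in a row of the
quadruple is a product of four entries of the quadruple. -/
theorem threeNormalize_switchRows (H : Matrix (Fin n) (Fin n) ℤ) (q : Fin 4 → Fin n) (t : Fin 4)
    (s : Fin 4) (c : Fin n) :
    threeNormalize (switchRows H q t) q (q s) c = threeNormalize H q (q s) c := by
  simp only [threeNormalize, of_apply]
  by_cases h : InField H q t c
  · simp only [switchRows_of_inField h]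
    ring
  · simp only [switchRows_of_not_inField h]

theorem inField_switchRows (H : Matrix (Fin n) (Fin n) ℤ) (q : Fin 4 → Fin n) (t : Fin 4)
    (c : Fin n) : InField (switchRows H q t) q t c ↔ InField H q t c :=
  forall_congr' fun s => by rw [threeNormalize_switchRows]

theorem switchRows_switchRows (H : Matrix (Fin n) (Fin n) ℤ) (q : Fin 4 → Fin n) (t : Fin 4) :
    switchRows (switchRows H q t) q t = H := by
  ext r c
  by_cases h : InField H q t c
  · by_cases hr : ∃ s, q s = r
    · obtain ⟨s, rfl⟩ := hr
      rw [switchRows_of_inField ((inField_switchRows H q t c).2 h), switchRows_of_inField h,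
        neg_neg]
    · push Not at hr
      rw [switchRows_of_not_mem hr, switchRows_of_not_mem hr]
  · rw [switchRows_of_not_inField (mt (inField_switchRows H q t c).1 h),
      switchRows_of_not_inField h]

theorem IsClosedQuadruple.switchRows {q : Fin 4 → Fin n} (h : IsClosedQuadruple H q) (t : Fin 4) :
    IsClosedQuadruple (switchRows H q t) q := by
  have key : ∀ c, _root_.switchRows H q t (q 0) c * _root_.switchRows H q t (q 1) c *
      _root_.switchRows H q t (q 2) c * _root_.switchRows H q t (q 3) c =
      H (q 0) c * H (q 1) c * H (q 2) c * H (q 3) c := by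
    intro c
    by_cases hc : InField H q t c
    · simp only [switchRows_of_inField hc]
      ring
    · simp only [switchRows_of_not_inField hc]
  refine ⟨h.1, ?_⟩
  simpa only [key] using h.2

theorem QStep.symm (h : QStep H K) : QStep K H := by
  cases h with
  | hadamard _ h => exact .hadamard _ _ h.symm
  | switchRowQuadruple q t h =>
    simpa only [switchRows_switchRows] using
      QStep.switchRowQuadruple (switchRows H q t) q t (h.switchRows t)
  | switchColQuadruple q t h =>
    simpa only [switchRows_switchRows, transpose_transpose] using
      QStep.switchColQuadruple (switchRows Hᵀ q t)ᵀ q t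
        (by simpa only [transpose_transpose] using h.switchRows t)

theorem QStep.transpose (h : QStep H K) : QStep Hᵀ Kᵀ := by
  cases h with
  | hadamard _ h => exact .hadamard _ _ h.transpose
  | switchRowQuadruple q t h => exact QStep.switchColQuadruple Hᵀ q t h
  | switchColQuadruple q t h => exact QStep.switchRowQuadruple Hᵀ q t h

theorem reflTransGen_qStep_symm (h : ReflTransGen QStep H K) : ReflTransGen QStep K H :=
  by
  induction h with
  | refl => exact .refl
  | tail _ h ih => exact ih.head h.symm

theorem reflTransGen_qStep_transpose (h : ReflTransGen QStep H K) :
    ReflTransGen QStep Hᵀ Kᵀ :=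
  h.lift _ fun _ _ h => h.transpose

/-- Negating any set of rows. -/
theorem reflTransGen_hStep_negRows (H : Matrix (Fin n) (Fin n) ℤ) (d : Fin n → ℤ)
    (hd : ∀ i, d i = 1 ∨ d i = -1) :
    ReflTransGen HStep H (Matrix.of fun i j => d i * H i j) := by
  have key : ∀ S : Finset (Fin n),
      ReflTransGen HStep H (Matrix.of fun i j => if i ∈ S then d i * H i j else H i j) := by
    intro S
    induction S using Finset.induction_on with
    | empty =>
      have : (Matrix.of fun i j =>
          if i ∈ (∅ : Finset (Fin n)) then d i * H i j else H i j) = H := by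
        ext; simp
      rw [this]
    | insert a S ha ih =>
      rcases hd a with h | h
      · convert ih using 1
        ext i j
        by_cases hi : i = a
        · subst hi; simp [ha, h]
        · simp [hi]
      · refine ih.tail ?_
        convert HStep.negateRow _ a using 1
        ext i j
        by_cases hi : i = a
        · subst hi; simp [ha, h, negRow]
        · simp [hi, negRow]
  convert key Finset.univ using 1
  ext; simp

/-- Negating any set of columns. -/
theorem reflTransGen_hStep_negCols (H : Matrix (Fin n) (Fin n) ℤ) (d : Fin n → ℤ)
    (hd : ∀ i, d i = 1 ∨ d i = -1) :
    ReflTransGen HStep H (Matrix.of fun i j => d j * H i j) :=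
  (reflTransGen_hStep_negRows Hᵀ d hd).lift transpose fun _ _ h => h.transpose

theorem isHadamard_negRow [NeZero n] (hH : H.IsHadamard) (r : Fin n) :
    (negRow H r).IsHadamard := by
  obtain ⟨h1, h2⟩ := (isHadamard_iff_rows H).1 hH
  rw [isHadamard_iff_rows]
  constructor
  · intro i j
    rw [negRow, of_apply]
    split_ifs <;> rcases h1 i j with h | h <;> simp [h]
  · intro i j
    have h : ∀ i c, negRow H r i c = (if i = r then -1 else 1) * H i c := by
      intro i c
      rw [negRow, of_apply]
      split_ifs <;> simp
    have hsum : ∑ c, negRow H r i c * negRow H r j c =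
        (if i = r then -1 else 1) * (if j = r then -1 else 1) * ∑ c, H i c * H j c := by
      rw [Finset.mul_sum]
      exact Finset.sum_congr rfl fun c _ => by rw [h, h]; ring
    rw [hsum, h2]
    by_cases hij : i = j
    · subst hij
      split_ifs <;> simp
    · simp [hij]

theorem HStep.isHadamard [NeZero n] (hH : H.IsHadamard) (h : HStep H K) : K.IsHadamard := by
  cases h with
  | negateRow r => exact isHadamard_negRow hH r
  | negateCol c => exact (isHadamard_negRow hH.transpose c).transpose
  | permuteRows σ => exact (isHadamard_submatrix_equiv_iff σ (Equiv.refl _)).2 hH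
  | permuteCols σ => exact (isHadamard_submatrix_equiv_iff (Equiv.refl _) σ).2 hH

theorem isHadamard_of_reflTransGen_hStep [NeZero n] (hH : H.IsHadamard)
    (h : ReflTransGen HStep H K) : K.IsHadamard := by
  induction h with
  | refl => exact hH
  | tail _ h ih => exact h.isHadamard ih

end Symmetry

/-! ### Moves on doubled matrices -/

-- `Fin.natAdd_eq_addNat` is switched off in `simp` because it would destroy the form
-- `Fin.natAdd n j` that the lemmas on the entries of a block matrix use.

section Block

variable {n : ℕ} (A B C D : Matrix (Fin n) (Fin n) ℤ) (i j : Fin n)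

theorem block_castAdd_castAdd : block A B C D (Fin.castAdd n i) (Fin.castAdd n j) = A i j := by
  simp [-Fin.natAdd_eq_addNat, block]

theorem block_castAdd_natAdd : block A B C D (Fin.castAdd n i) (Fin.natAdd n j) = B i j := by
  simp [-Fin.natAdd_eq_addNat, block]

theorem block_natAdd_castAdd : block A B C D (Fin.natAdd n i) (Fin.castAdd n j) = C i j := by
  simp [-Fin.natAdd_eq_addNat, block]

theorem block_natAdd_natAdd : block A B C D (Fin.natAdd n i) (Fin.natAdd n j) = D i j := by
  simp [-Fin.natAdd_eq_addNat, block]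

theorem eq_block_iff (M : Matrix (Fin (n + n)) (Fin (n + n)) ℤ) :
    M = block A B C D ↔ ∀ i j : Fin n,
      M (Fin.castAdd n i) (Fin.castAdd n j) = A i j ∧ M (Fin.castAdd n i) (Fin.natAdd n j) = B i j ∧
      M (Fin.natAdd n i) (Fin.castAdd n j) = C i j ∧
      M (Fin.natAdd n i) (Fin.natAdd n j) = D i j := by
  constructor
  · rintro rfl i j
    exact ⟨block_castAdd_castAdd .., block_castAdd_natAdd .., block_natAdd_castAdd ..,
      block_natAdd_natAdd ..⟩
  · intro h
    ext r c
    induction r using Fin.addCases <;> induction c using Fin.addCases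
    · rw [(h _ _).1, block_castAdd_castAdd]
    · rw [(h _ _).2.1, block_castAdd_natAdd]
    · rw [(h _ _).2.2.1, block_natAdd_castAdd]
    · rw [(h _ _).2.2.2, block_natAdd_natAdd]

theorem transpose_block : (block A B C D)ᵀ = block Aᵀ Cᵀ Bᵀ Dᵀ := by
  rw [eq_block_iff]
  intro i j
  exact ⟨block_castAdd_castAdd .., block_natAdd_castAdd .., block_castAdd_natAdd ..,
    block_natAdd_natAdd ..⟩

end Block

section Lift

variable {n : ℕ}

theorem castAdd_ne_natAdd (i j : Fin n) : Fin.castAdd n i ≠ Fin.natAdd n j := by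
  intro h
  have := congrArg Fin.val h
  simp at this
  omega

/-- The four fields of a quadruple of rows of `A` extend to the doubled matrix by repeating them in
the second half of the columns. -/
theorem block_switchRows (A B : Matrix (Fin n) (Fin n) ℤ) (q : Fin 4 → Fin n) (t : Fin 4) :
    switchRows (block A A B (-B)) (fun s => Fin.castAdd n (q s)) t =
      block (switchRows A q t) (switchRows A q t) B (-B) := by
  have hq : ∀ i, (∃ s, Fin.castAdd n (q s) = Fin.castAdd n i) ↔ ∃ s, q s = i := by
    simp [-Fin.natAdd_eq_addNat, Fin.castAdd_inj]
  have hn : ∀ i s, Fin.castAdd n (q s) ≠ Fin.natAdd n i := fun i s => castAdd_ne_natAdd _ _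
  have hL : ∀ c, InField (block A A B (-B)) (fun s => Fin.castAdd n (q s)) t (Fin.castAdd n c) ↔
      InField A q t c := by
    intro c
    simp [-Fin.natAdd_eq_addNat, InField, threeNormalize, block_castAdd_castAdd]
  have hR : ∀ c, InField (block A A B (-B)) (fun s => Fin.castAdd n (q s)) t (Fin.natAdd n c) ↔
      InField A q t c := by
    intro c
    simp [-Fin.natAdd_eq_addNat, InField, threeNormalize, block_castAdd_natAdd]
  rw [eq_block_iff]
  intro i j
  refine ⟨?_, ?_, ?_, ?_⟩
  · simp only [switchRows, of_apply, hq, hL, block_castAdd_castAdd]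
  · simp only [switchRows, of_apply, hq, hR, block_castAdd_natAdd]
  · rw [switchRows_of_not_mem (hn i), block_natAdd_castAdd]
  · rw [switchRows_of_not_mem (hn i), block_natAdd_natAdd]

/-- The columns `p` and `p'` of the upper half of a doubled matrix are interchanged by switching the
closed quadruple formed by the columns `p` and `p'` of both halves. -/
theorem qStep_block_swapCols {A B : Matrix (Fin n) (Fin n) ℤ}
    (hA : ∀ i j, A i j = 1 ∨ A i j = -1) (hB : ∀ i j, B i j = 1 ∨ B i j = -1)
    {p p' : Fin n} (hp : p ≠ p') :
    QStep (block A A B (-B))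
      (block (A.submatrix id (Equiv.swap p p')) (A.submatrix id (Equiv.swap p p')) B (-B)) := by
  set q : Fin 4 → Fin (n + n) :=
    ![Fin.castAdd n p, Fin.natAdd n p, Fin.castAdd n p', Fin.natAdd n p'] with hq
  have hcl : IsClosedQuadruple (block A A B (-B))ᵀ q := by
    constructor
    · have h1 := castAdd_ne_natAdd (n := n)
      have h2 := fun i j => (h1 i j).symm
      intro a b
      fin_cases a <;> fin_cases b <;> simp [-Fin.natAdd_eq_addNat,
          hq, h1, h2, hp, hp.symm, Fin.castAdd_inj]
    · left
      intro r
      induction r using Fin.addCases with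
      | left i =>
        rcases hA i p with h | h <;> rcases hA i p' with h' | h' <;>
          simp [-Fin.natAdd_eq_addNat, hq, block_castAdd_castAdd, block_castAdd_natAdd, h, h']
      | right i =>
        rcases hB i p with h | h <;> rcases hB i p' with h' | h' <;>
          simp [-Fin.natAdd_eq_addNat, hq, block_natAdd_castAdd, block_natAdd_natAdd, h, h']
  -- field number `1` consists of the upper rows in which the columns `p` and `p'` differ
  convert QStep.switchColQuadruple _ q 1 hcl using 1
  have hfL : ∀ i, InField (block A A B (-B))ᵀ q 1 (Fin.castAdd n i) ↔ A i p ≠ A i p' := by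
    intro i
    rcases hA i p with h | h <;> rcases hA i p' with h' | h' <;>
      simp [-Fin.natAdd_eq_addNat,
          InField, threeNormalize, fieldPattern, Fin.forall_fin_succ, hq, block_castAdd_castAdd,
        block_castAdd_natAdd, h, h']
  have hfR : ∀ i, ¬InField (block A A B (-B))ᵀ q 1 (Fin.natAdd n i) := by
    intro i
    rcases hB i p with h | h <;> rcases hB i p' with h' | h' <;>
      simp [-Fin.natAdd_eq_addNat,
          InField, threeNormalize, fieldPattern, Fin.forall_fin_succ, hq, block_natAdd_castAdd,
        block_natAdd_natAdd, h, h']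
  have hqL : ∀ j, (∃ s, q s = Fin.castAdd n j) ↔ j = p ∨ j = p' := by
    intro j
    simp [-Fin.natAdd_eq_addNat,
        hq, Fin.exists_fin_succ, Fin.castAdd_inj, castAdd_ne_natAdd, eq_comm]
  have hqR : ∀ j, (∃ s, q s = Fin.natAdd n j) ↔ j = p ∨ j = p' := by
    intro j
    simp [-Fin.natAdd_eq_addNat, hq, Fin.exists_fin_succ, castAdd_ne_natAdd, eq_comm]
  have hval : ∀ i j, (if (j = p ∨ j = p') ∧ A i p ≠ A i p' then -A i j else A i j) =
      A i (Equiv.swap p p' j) := by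
    intro i j
    by_cases h1 : j = p
    · subst h1
      rcases hA i j with h | h <;> rcases hA i p' with h' | h' <;> simp [-Fin.natAdd_eq_addNat,
          h, h']
    by_cases h2 : j = p'
    · subst h2
      rcases hA i p with h | h <;> rcases hA i j with h' | h' <;> simp [-Fin.natAdd_eq_addNat,
          h, h']
    simp [-Fin.natAdd_eq_addNat, h1, h2, Equiv.swap_apply_of_ne_of_ne]
  symm
  rw [eq_block_iff]
  intro i j
  refine ⟨?_, ?_, ?_, ?_⟩
  · simp only [switchRows, of_apply, transpose_apply, hqL, hfL, block_castAdd_castAdd, hval,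
      submatrix_apply, id]
  · simp only [switchRows, of_apply, transpose_apply, hqR, hfL, block_castAdd_natAdd, hval,
      submatrix_apply, id]
  · rw [transpose_apply, switchRows_of_not_inField (hfR i), transpose_apply, block_natAdd_castAdd]
  · rw [transpose_apply, switchRows_of_not_inField (hfR i), transpose_apply, block_natAdd_natAdd]

/-- The columns of the upper half of a doubled matrix can be permuted independently. -/
theorem block_permCols {A B : Matrix (Fin n) (Fin n) ℤ}
    (hA : ∀ i j, A i j = 1 ∨ A i j = -1) (hB : ∀ i j, B i j = 1 ∨ B i j = -1)
    (σ : Equiv.Perm (Fin n)) :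
    ReflTransGen QStep (block A A B (-B))
      (block (A.submatrix id σ) (A.submatrix id σ) B (-B)) := by
  induction σ using Equiv.Perm.swap_induction_on' with
  | one => exact .refl
  | mul_swap f x y hxy ih =>
    exact ih.tail (qStep_block_swapCols (A := A.submatrix id f) (fun i j => hA _ _) hB hxy)

/-- Negating the column `p` of both halves and interchanging the two negated columns leaves the
lower half as it was. -/
theorem block_negCol (A B : Matrix (Fin n) (Fin n) ℤ) (p : Fin n) :
    ReflTransGen QStep (block A A B (-B))
      (block (negRow Aᵀ p)ᵀ (negRow Aᵀ p)ᵀ B (-B)) := by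
  have h1 := QStep.hadamard _ _ (HStep.negateCol (block A A B (-B)) (Fin.castAdd n p))
  have h2 := QStep.hadamard _ _
    (HStep.negateCol (negRow (block A A B (-B))ᵀ (Fin.castAdd n p))ᵀ (Fin.natAdd n p))
  have h3 := QStep.hadamard _ _ (HStep.permuteCols
    (negRow (negRow (block A A B (-B))ᵀ (Fin.castAdd n p))ᵀᵀ (Fin.natAdd n p))ᵀ
    (Equiv.swap (Fin.castAdd n p) (Fin.natAdd n p)))
  convert ((ReflTransGen.single h1).tail h2).tail h3 using 1
  symm
  have hne := castAdd_ne_natAdd (n := n)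
  have hne' := fun i j => (hne i j).symm
  rw [eq_block_iff]
  intro i j
  by_cases hj : j = p
  · subst hj
    simp [-Fin.natAdd_eq_addNat,
        negRow, hne, hne', block_castAdd_castAdd, block_castAdd_natAdd, block_natAdd_castAdd,
      block_natAdd_natAdd]
  · have e1 : Equiv.swap (Fin.castAdd n p) (Fin.natAdd n p) (Fin.castAdd n j) = Fin.castAdd n j :=
      Equiv.swap_apply_of_ne_of_ne (by simpa [Fin.castAdd_inj] using hj) (hne _ _)
    have e2 : Equiv.swap (Fin.castAdd n p) (Fin.natAdd n p) (Fin.natAdd n j) = Fin.natAdd n j :=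
      Equiv.swap_apply_of_ne_of_ne (hne' _ _) (by simpa using hj)
    simp [-Fin.natAdd_eq_addNat,
        negRow, hne, hne', hj, e1, e2, block_castAdd_castAdd, block_castAdd_natAdd,
      block_natAdd_castAdd, block_natAdd_natAdd, Fin.castAdd_inj]

/-- Every move on `A` that does not switch columns lifts to the doubled matrix. -/
theorem RowSwitchStep.block {A A' B : Matrix (Fin n) (Fin n) ℤ}
    (hA : ∀ i j, A i j = 1 ∨ A i j = -1) (hB : ∀ i j, B i j = 1 ∨ B i j = -1)
    (h : RowSwitchStep A A') :
    ReflTransGen QStep (block A A B (-B)) (_root_.block A' A' B (-B)) := by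
  cases h with
  | switchRowQuadruple q t h =>
    rw [← block_switchRows]
    refine .single (.switchRowQuadruple _ _ t ⟨(Fin.castAdd_injective n n).comp h.1, ?_⟩)
    refine h.2.imp (fun h c => ?_) (fun h c => ?_) <;>
    induction c using Fin.addCases <;>
    simp only [block_castAdd_castAdd, block_castAdd_natAdd, h]
  | hadamard _ h =>
    cases h with
    | negateRow r =>
      convert ReflTransGen.single (QStep.hadamard _ _
        (HStep.negateRow (_root_.block A A B (-B)) (Fin.castAdd n r))) using 1
      symm
      rw [eq_block_iff]
      intro i j
      simp [-Fin.natAdd_eq_addNat,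
          negRow, block_castAdd_castAdd, block_castAdd_natAdd, block_natAdd_castAdd,
        block_natAdd_natAdd, Fin.castAdd_inj, (castAdd_ne_natAdd _ _).symm]
    | negateCol c => exact block_negCol A B c
    | permuteCols σ => exact block_permCols hA hB σ
    | permuteRows σ =>
      convert ReflTransGen.single (QStep.hadamard _ _
        (HStep.permuteRows (_root_.block A A B (-B))
          (finSumFinEquiv.permCongr (Equiv.Perm.sumCongr σ 1)))) using 1
      symm
      rw [eq_block_iff]
      intro i j
      simp [-Fin.natAdd_eq_addNat,
          block_castAdd_castAdd, block_castAdd_natAdd, block_natAdd_castAdd,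
        block_natAdd_natAdd, Equiv.permCongr_apply]

theorem RowSwitchStep.entry {A A' : Matrix (Fin n) (Fin n) ℤ}
    (hA : ∀ i j, A i j = 1 ∨ A i j = -1) (h : RowSwitchStep A A') :
    ∀ i j, A' i j = 1 ∨ A' i j = -1 := by
  have hneg : ∀ i j, -A i j = 1 ∨ -A i j = -1 := fun i j => by
    rcases hA i j with h | h <;> simp [-Fin.natAdd_eq_addNat, h]
  intro i j
  cases h with
  | switchRowQuadruple q t h => rw [switchRows, of_apply]; split_ifs <;> simp only [hA, hneg]
  | hadamard _ h =>
    cases h with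
    | negateRow r => rw [negRow, of_apply]; split_ifs <;> simp only [hA, hneg]
    | negateCol c =>
      rw [transpose_apply, negRow, of_apply]; split_ifs <;> simp only [transpose_apply, hA, hneg]
    | permuteCols σ => exact hA _ _
    | permuteRows σ => exact hA _ _

theorem reflTransGen_qStep_block {A A' B : Matrix (Fin n) (Fin n) ℤ}
    (hA : ∀ i j, A i j = 1 ∨ A i j = -1) (hB : ∀ i j, B i j = 1 ∨ B i j = -1)
    (h : ReflTransGen RowSwitchStep A A') :
    ReflTransGen QStep (block A A B (-B)) (block A' A' B (-B)) := by
  suffices ReflTransGen QStep (block A A B (-B)) (block A' A' B (-B)) ∧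
      ∀ i j, A' i j = 1 ∨ A' i j = -1 from this.1
  induction h with
  | refl => exact ⟨.refl, hA⟩
  | tail _ h ih => exact ⟨ih.1.trans (h.block ih.2 hB), h.entry ih.2⟩

/-- The two halves of a doubled matrix can be interchanged. -/
theorem reflTransGen_qStep_block_swap (A B : Matrix (Fin n) (Fin n) ℤ) :
    ReflTransGen QStep (block A A B (-B)) (block B B A (-A)) := by
  have h1 := QStep.hadamard _ _ (HStep.permuteRows (block A A B (-B))
    (finSumFinEquiv.permCongr (Equiv.sumComm (Fin n) (Fin n))))
  have h2 := (reflTransGen_hStep_negCols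
    ((block A A B (-B)).submatrix (finSumFinEquiv.permCongr (Equiv.sumComm (Fin n) (Fin n))) id)
    (Fin.addCases (fun _ => 1) (fun _ => -1)) (by
      intro i
      induction i using Fin.addCases <;> simp [-Fin.natAdd_eq_addNat]))
  convert (ReflTransGen.single h1).trans (h2.lift id QStep.hadamard) using 1
  symm
  rw [eq_block_iff]
  intro i j
  simp [-Fin.natAdd_eq_addNat, block_castAdd_castAdd, block_castAdd_natAdd, block_natAdd_castAdd,
    block_natAdd_natAdd, Equiv.permCongr_apply]

theorem isHadamard_block [NeZero n] {A B : Matrix (Fin n) (Fin n) ℤ} (hA : A.IsHadamard)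
    (hB : B.IsHadamard) : (block A A B (-B)).IsHadamard := by
  obtain ⟨hA1, hA2⟩ := (isHadamard_iff_rows A).1 hA
  obtain ⟨hB1, hB2⟩ := (isHadamard_iff_rows B).1 hB
  have : NeZero (n + n) := ⟨by have := NeZero.ne n; omega⟩
  rw [isHadamard_iff_rows]
  constructor
  · intro i j
    induction i using Fin.addCases <;> induction j using Fin.addCases <;>
      simp [-Fin.natAdd_eq_addNat,
          block_castAdd_castAdd, block_castAdd_natAdd, block_natAdd_castAdd,
        block_natAdd_natAdd, hA1, hB1, neg_eq_iff_eq_neg, or_comm]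
  · intro i j
    rw [Fin.sum_univ_add]
    induction i using Fin.addCases <;> induction j using Fin.addCases <;>
      simp [-Fin.natAdd_eq_addNat,
          block_castAdd_castAdd, block_castAdd_natAdd, block_natAdd_castAdd,
        block_natAdd_natAdd, hA2, hB2, Fin.castAdd_inj, castAdd_ne_natAdd,
        (castAdd_ne_natAdd _ _).symm] <;>
      split_ifs <;> simp

end Lift

/-! ### Vectors that become rows by switching -/

namespace Matrix.IsHadamard

/-- The triple product of three rows has an inner product divisible by `8` with every row. This
is because each of the factors `1 + ab`, `1 + ad` and `1 + abdr` is `0` or `2` in every column,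
and the sum of their product over the columns is this inner product up to multiples of `16`. -/
theorem eight_dvd_inner {H : Matrix (Fin 16) (Fin 16) ℤ} (hH : H.IsHadamard) {a b d : Fin 16}
    (hab : a ≠ b) (had : a ≠ d) (hbd : b ≠ d) (r : Fin 16) :
    8 ∣ ∑ c, H a c * H b c * H d c * H r c := by
  have hrow := ((isHadamard_iff_rows H).1 hH).2
  have h16 : ∀ i, (8 : ℤ) ∣ ∑ c, H i c * H r c := fun i => by
    rw [hrow]; split_ifs <;> norm_num
  have hdvd : (8 : ℤ) ∣ ∑ c, (1 + H a c * H b c) * (1 + H a c * H d c) *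
      (1 + H a c * H b c * H d c * H r c) := by
    refine Finset.dvd_sum fun c _ => ?_
    rcases hH.entry a c with ha | ha <;> rcases hH.entry b c with hb | hb <;>
      rcases hH.entry d c with hd | hd <;> rcases hH.entry r c with hr | hr <;>
      simp [ha, hb, hd, hr]
  have hexp : ∑ c, (1 + H a c * H b c) * (1 + H a c * H d c) *
      (1 + H a c * H b c * H d c * H r c) =
      16 + ∑ c, H a c * H b c + ∑ c, H a c * H d c + ∑ c, H b c * H d c +
        ∑ c, H a c * H r c + ∑ c, H b c * H r c + ∑ c, H d c * H r c +
        ∑ c, H a c * H b c * H d c * H r c := by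
    have h1 : (16 : ℤ) = ∑ _c : Fin 16, 1 := by simp
    rw [h1]
    simp only [← Finset.sum_add_distrib]
    refine Finset.sum_congr rfl fun c _ => ?_
    linear_combination (H b c * H d c + H b c * H d c ^ 2 * H r c + H b c ^ 2 * H d c * H r c +
        H a c * H b c ^ 2 * H d c ^ 2 * H r c) * hH.entry_mul_self a c +
      (H d c * H r c + H a c * H r c * H d c ^ 2) * hH.entry_mul_self b c +
      (H b c * H r c + H a c * H r c) * hH.entry_mul_self d c
  rw [hexp, hH.row_orthogonal hab, hH.row_orthogonal had, hH.row_orthogonal hbd] at hdvd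
  have := h16 a
  have := h16 b
  have := h16 d
  omega

end Matrix.IsHadamard

/-- If four signed entries have the sum `2 w`, exactly one of them is `-w`. For given signs, one
field `t` consists of the columns in which this is the first one. -/
theorem exists_field_of_sum_eq : ∀ e₀ ∈ ({1, -1} : Finset ℤ), ∀ e₁ ∈ ({1, -1} : Finset ℤ),
    ∀ e₂ ∈ ({1, -1} : Finset ℤ), ∀ e₃ ∈ ({1, -1} : Finset ℤ), ∃ t : Fin 4,
    ∀ w ∈ ({1, -1} : Finset ℤ), ∀ p₀ ∈ ({1, -1} : Finset ℤ), ∀ p₁ ∈ ({1, -1} : Finset ℤ),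
    ∀ p₂ ∈ ({1, -1} : Finset ℤ), ∀ p₃ ∈ ({1, -1} : Finset ℤ),
    e₀ * p₀ + e₁ * p₁ + e₂ * p₂ + e₃ * p₃ = 2 * w →
    p₀ * p₁ * p₂ * p₃ = -(e₀ * e₁ * e₂ * e₃) ∧
    ((p₀ * p₁ * p₂ * p₀ = fieldPattern t 0 ∧ p₀ * p₁ * p₂ * p₁ = fieldPattern t 1 ∧
      p₀ * p₁ * p₂ * p₂ = fieldPattern t 2) ↔ e₀ * p₀ = -w) ∧
    (e₀ * p₀ = -w → e₁ * p₁ = w ∧ e₂ * p₂ = w ∧ e₃ * p₃ = w) := by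
  decide +kernel

section Realize

variable {H : Matrix (Fin 16) (Fin 16) ℤ} {w : Fin 16 → ℤ} {m : Fin 16 → ℤ}

/-- The expansion of `w` in the orthogonal basis of the rows. -/
theorem two_mul_eq_sum (hH : H.IsHadamard) (hm : ∀ r, ∑ c, w c * H r c = 8 * m r) (c : Fin 16) :
    2 * w c = ∑ r, m r * H r c := by
  have h : ∑ r, (∑ d, w d * H r d) * H r c = 16 * w c := by
    simp only [Finset.sum_mul, mul_assoc]
    rw [Finset.sum_comm]
    simp only [← Finset.mul_sum, hH.col_inner]
    simp [mul_comm]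
  simp only [hm, mul_assoc, ← Finset.mul_sum] at h
  omega

/-- Parseval's identity for `w`. -/
theorem sum_sq_eq_four (hH : H.IsHadamard) (hw : ∀ c, w c = 1 ∨ w c = -1)
    (hm : ∀ r, ∑ c, w c * H r c = 8 * m r) : ∑ r, m r ^ 2 = 4 := by
  have h1 : ∑ c, w c * (2 * w c) = 32 := by
    have : ∀ c, w c * (2 * w c) = 2 := fun c => by rcases hw c with h | h <;> simp [h]
    simp [this]
  have h2 : ∑ c, w c * (2 * w c) = ∑ r, m r * (8 * m r) := by
    simp only [two_mul_eq_sum hH hm, Finset.mul_sum, ← hm]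
    rw [Finset.sum_comm]
    exact Finset.sum_congr rfl fun r _ => Finset.sum_congr rfl fun c _ => by ring
  have h3 : ∑ r, m r * (8 * m r) = 8 * ∑ r, m r ^ 2 := by
    rw [Finset.mul_sum]
    exact Finset.sum_congr rfl fun r _ => by ring
  omega

/-- If `w` is half of a signed sum of four rows, these rows form a closed quadruple, and switching
one of its fields turns the first of them into `w` or `-w`. -/
theorem exists_switchRows_of_two_mul_eq_sum (hH : H.IsHadamard) (hw : ∀ c, w c = 1 ∨ w c = -1)
    {q : Fin 4 → Fin 16} (hq : Function.Injective q) {e : Fin 4 → ℤ}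
    (he : ∀ s, e s = 1 ∨ e s = -1) (hsum : ∀ c, 2 * w c = ∑ s, e s * H (q s) c)
    (hout : ∀ r, (∀ s, q s ≠ r) → ∑ c, w c * H r c = 0) :
    ∃ t, IsClosedQuadruple H q ∧ (switchRows H q t).IsHadamard ∧
      ∀ c, switchRows H q t (q 0) c = e 0 * w c := by
  have mem : ∀ {a : ℤ}, a = 1 ∨ a = -1 → a ∈ ({1, -1} : Finset ℤ) := fun h => by
    simpa using h
  obtain ⟨t, ht⟩ := exists_field_of_sum_eq (e 0) (mem (he 0)) (e 1) (mem (he 1))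
    (e 2) (mem (he 2)) (e 3) (mem (he 3))
  have ht' := fun c => ht (w c) (mem (hw c)) _ (mem (hH.entry (q 0) c)) _ (mem (hH.entry (q 1) c))
    _ (mem (hH.entry (q 2) c)) _ (mem (hH.entry (q 3) c))
    (by rw [hsum c, Fin.sum_univ_four])
  clear ht
  have hcl : IsClosedQuadruple H q := by
    refine ⟨hq, ?_⟩
    have : -(e 0 * e 1 * e 2 * e 3) = 1 ∨ -(e 0 * e 1 * e 2 * e 3) = -1 := by
      rcases he 0 with h0 | h0 <;> rcases he 1 with h1 | h1 <;> rcases he 2 with h2 | h2 <;>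
        rcases he 3 with h3 | h3 <;> simp [h0, h1, h2, h3]
    exact this.imp (fun h c => (ht' c).1.trans h) fun h c => (ht' c).1.trans h
  have hfield : ∀ c, InField H q t c ↔ e 0 * H (q 0) c = -w c := by
    intro c
    rw [← (ht' c).2.1]
    simp [InField, threeNormalize, Fin.forall_fin_succ]
  set K := switchRows H q t with hK
  have hent : ∀ r c, K r c = 1 ∨ K r c = -1 :=
    (RowSwitchStep.switchRowQuadruple H q t hcl).entry hH.entry
  have hfirst : ∀ c, K (q 0) c = e 0 * w c := by
    intro c
    by_cases h : InField H q t c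
    · rw [hK, switchRows_of_inField h]
      have := (hfield c).1 h
      rcases he 0 with h | h <;> rw [h] at this ⊢ <;> omega
    · rw [hK, switchRows_of_not_inField h]
      rw [hfield] at h
      rcases he 0 with h0 | h0 <;> rcases hH.entry (q 0) c with h1 | h1 <;>
        rcases hw c with h2 | h2 <;> simp [h0, h1, h2] at h ⊢
  -- the switched rows differ from the old ones by a combination of `w` and the first old row
  have hlin : ∀ s c, K (q s) c = H (q s) c -
      (if s = 0 then -e 0 else e s) * (w c - e 0 * H (q 0) c) := by
    intro s c
    have hsq : ∀ s, e s * e s = 1 := fun s => by rcases he s with h | h <;> simp [h]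
    by_cases h : InField H q t c
    · have h0 := (hfield c).1 h
      obtain ⟨h1, h2, h3⟩ := (ht' c).2.2 h0
      have hne : s ≠ 0 → e s * H (q s) c = w c := by
        fin_cases s <;> simp [h1, h2, h3]
      rw [hK, switchRows_of_inField h]
      split_ifs with hs
      · subst hs
        linear_combination -e 0 * h0 + 2 * H (q 0) c * hsq 0
      · linear_combination -e s * h0 - 2 * e s * hne hs + 2 * H (q s) c * hsq s
    · have h0 : e 0 * H (q 0) c = w c := by
        have h' := mt (hfield c).2 h
        rcases he 0 with h0 | h0 <;> rcases hH.entry (q 0) c with h1 | h1 <;>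
          rcases hw c with h2 | h2 <;> simp [h0, h1, h2] at h' ⊢
      rw [hK, switchRows_of_not_inField h, h0, sub_self, mul_zero, sub_zero]
  have hmixed : ∀ s r, (∀ s, q s ≠ r) → ∑ c, K (q s) c * H r c = 0 := by
    intro s r hr
    have h1 := hH.row_orthogonal (hr s)
    have h2 := hH.row_orthogonal (hr 0)
    have h3 := hout r hr
    simp only [hlin, sub_mul, Finset.sum_sub_distrib, mul_sub, mul_assoc, ← Finset.mul_sum, h1,
      h2, h3]
    simp
  refine ⟨t, hcl, ?_, hfirst⟩
  rw [isHadamard_iff_rows]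
  refine ⟨hent, fun i j => ?_⟩
  have hrow := ((isHadamard_iff_rows H).1 hH).2
  by_cases hi : ∃ s, q s = i
  · obtain ⟨s, rfl⟩ := hi
    by_cases hj : ∃ s, q s = j
    · obtain ⟨s', rfl⟩ := hj
      rw [← hrow]
      refine Finset.sum_congr rfl fun c _ => ?_
      by_cases h : InField H q t c
      · simp only [switchRows_of_inField h, neg_mul_neg]
      · simp only [switchRows_of_not_inField h]
    · push Not at hj
      simp only [switchRows_of_not_mem hj]
      rw [if_neg (hj s)]
      exact hmixed s j hj
  · push Not at hi
    by_cases hj : ∃ s, q s = j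
    · obtain ⟨s, rfl⟩ := hj
      rw [if_neg (hi s).symm, ← hmixed s i hi]
      exact Finset.sum_congr rfl fun c _ => by rw [hK, switchRows_of_not_mem hi, mul_comm]
    · push Not at hj
      rw [← hrow]
      exact Finset.sum_congr rfl fun c _ => by
        rw [switchRows_of_not_mem hi, switchRows_of_not_mem hj]

/-- A `±1` vector `w` whose inner products with the rows are divisible by `8` is, up to sign, a row
of the matrix or becomes one by a switching that affects no row orthogonal to `w`. -/
theorem exists_rowSwitch_row_eq (hH : H.IsHadamard) (hw : ∀ c, w c = 1 ∨ w c = -1)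
    (h8 : ∀ r, 8 ∣ ∑ c, w c * H r c) :
    ∃ K : Matrix (Fin 16) (Fin 16) ℤ, ReflTransGen RowSwitchStep H K ∧ K.IsHadamard ∧
      (∃ p, ∃ e : ℤ, (e = 1 ∨ e = -1) ∧ ∑ c, w c * H p c ≠ 0 ∧ ∀ c, K p c = e * w c) ∧
      ∀ r, ∑ c, w c * H r c = 0 → ∀ c, K r c = H r c := by
  choose m hm using h8
  have h4 := sum_sq_eq_four hH hw hm
  have h2 := two_mul_eq_sum hH hm
  by_cases hbig : ∃ r, 2 ≤ |m r|
  · obtain ⟨r, hr⟩ := hbig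
    have hr4 : 4 ≤ m r ^ 2 := by rw [← sq_abs]; nlinarith
    rw [← Finset.add_sum_erase _ _ (Finset.mem_univ r)] at h4
    have hnn : ∀ i ∈ Finset.univ.erase r, 0 ≤ m i ^ 2 := fun i _ => sq_nonneg _
    have h0 := Finset.sum_nonneg hnn
    have hz : ∀ i, i ≠ r → m i = 0 := by
      intro i hi
      have := (Finset.sum_eq_zero_iff_of_nonneg hnn).1 (by omega) i (by simpa using hi)
      simpa using this
    have hr2 : m r = 2 ∨ m r = -2 := by
      have : (m r - 2) * (m r + 2) = 0 := by linarith
      rcases mul_eq_zero.1 this with h | h <;> omega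
    refine ⟨H, .refl, hH, ⟨r, if m r = 2 then 1 else -1, ?_, ?_, ?_⟩, fun _ _ _ => rfl⟩
    · split_ifs <;> simp
    · rw [hm]; omega
    · intro c
      have := h2 c
      rw [Finset.sum_eq_single r (fun i _ hi => by rw [hz i hi, zero_mul]) (by simp)] at this
      rcases hr2 with h | h <;> rw [h] at this ⊢ <;> simp <;> omega
  · push Not at hbig
    have hcase : ∀ r, m r = 0 ∨ m r = 1 ∨ m r = -1 := fun r => by
      have := abs_lt.1 (hbig r)
      omega
    set S : Finset (Fin 16) := {r | m r ≠ 0} with hS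
    have hcard : S.card = 4 := by
      have : ∑ r, m r ^ 2 = ∑ r, if m r ≠ 0 then 1 else 0 := Finset.sum_congr rfl fun r _ => by
        rcases hcase r with h | h | h <;> simp [h]
      rw [this, ← Finset.sum_filter, Finset.sum_const, nsmul_eq_mul, mul_one] at h4
      rw [hS]
      exact_mod_cast h4
    set q := S.orderEmbOfFin hcard with hq
    have hqS : ∀ r, (∃ s, q s = r) ↔ m r ≠ 0 := by
      intro r
      have := Set.ext_iff.1 (S.range_orderEmbOfFin hcard) r
      exact this.trans (by simp [hS])
    have hsum : ∀ c, 2 * w c = ∑ s, m (q s) * H (q s) c := by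
      intro c
      rw [h2, ← Finset.sum_subset (Finset.subset_univ S)
        (fun r _ hr => by
          simp only [hS, Finset.mem_filter, Finset.mem_univ, true_and, not_not] at hr
          rw [hr, zero_mul]),
        ← S.map_orderEmbOfFin_univ hcard, Finset.sum_map]
      rfl
    have hout : ∀ r, (∀ s, q s ≠ r) → m r = 0 := fun r hr => by
      by_contra h
      obtain ⟨s, hs⟩ := (hqS r).2 h
      exact hr s hs
    have he : ∀ s, m (q s) = 1 ∨ m (q s) = -1 := fun s =>
      (hcase (q s)).resolve_left ((hqS _).1 ⟨s, rfl⟩)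
    obtain ⟨t, hcl, hK, hfirst⟩ := exists_switchRows_of_two_mul_eq_sum hH hw q.injective he hsum
      (fun r hr => by rw [hm, hout r hr, mul_zero])
    refine ⟨_, .single (.switchRowQuadruple H q t hcl), hK,
      ⟨q 0, m (q 0), he 0, ?_, hfirst⟩, ?_⟩
    · rw [hm]
      rcases he 0 with h | h <;> rw [h] <;> norm_num
    · intro r hr c
      refine switchRows_of_not_mem (fun s hs => ?_) c
      rw [hm] at hr
      exact (hqS r).1 ⟨s, hs⟩ (by omega)

end Realize

/-! ### Reaching the Sylvester matrix of order 16 -/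

/-- The rows with the numbers `1`, `2`, `4`, `8`. -/
def bitRow : Fin 4 → Fin 16 := ![1, 2, 4, 8]

/-- The entrywise product of those rows `2 ^ i` for which `2 ^ i` occurs in the binary expansion of
`x`. -/
def walshRow (H : Matrix (Fin 16) (Fin 16) ℤ) (x : Fin 16) (c : Fin 16) : ℤ :=
  ∏ i : Fin 4, if x.val.testBit i then H (bitRow i) c else 1

/-- The first `k` rows of the Hadamard matrix `H` are given by binary expansion from the rows with
the numbers `1`, `2`, `4`, `8`. -/
structure IsWalshBelow (k : ℕ) (H : Matrix (Fin 16) (Fin 16) ℤ) : Prop where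
  isHadamard : H.IsHadamard
  row_eq (x : Fin 16) : x.val < k → ∀ c, H x c = walshRow H x c

section Walsh

variable {H K : Matrix (Fin 16) (Fin 16) ℤ}

theorem walshRow_zero (H : Matrix (Fin 16) (Fin 16) ℤ) (c : Fin 16) : walshRow H 0 c = 1 := by
  simp [walshRow]

theorem walshRow_bitRow (H : Matrix (Fin 16) (Fin 16) ℤ) (i : Fin 4) (c : Fin 16) :
    walshRow H (bitRow i) c = H (bitRow i) c := by
  have : ∀ i j : Fin 4, (bitRow i).val.testBit j = decide (j = i) := by decide
  simp [walshRow, this]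

theorem walshRow_mul_walshRow (hH : H.IsHadamard) {x y z : Fin 16} (h : x ^^^ y = z) (c : Fin 16) :
    walshRow H x c * walshRow H y c = walshRow H z c := by
  have hbit : ∀ (x y : Fin 16) (i : Fin 4),
      (x ^^^ y).val.testBit i = (x.val.testBit i ^^ y.val.testBit i) := by decide +kernel
  subst h
  rw [walshRow, walshRow, walshRow, ← Finset.prod_mul_distrib]
  refine Finset.prod_congr rfl fun i _ => ?_
  rw [hbit]
  cases x.val.testBit i <;> cases y.val.testBit i <;> simp [hH.entry_mul_self]

theorem walshRow_entry (hH : H.IsHadamard) (x c : Fin 16) :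
    walshRow H x c = 1 ∨ walshRow H x c = -1 := by
  have h : walshRow H x c * walshRow H x c = 1 := by
    have hx : ∀ x : Fin 16, x ^^^ x = 0 := by decide
    rw [walshRow_mul_walshRow hH (hx x), walshRow_zero]
  exact mul_self_eq_one_iff.1 h

theorem walshRow_congr {x : Fin 16}
    (h : ∀ i : Fin 4, x.val.testBit i → ∀ c, K (bitRow i) c = H (bitRow i) c) (c : Fin 16) :
    walshRow K x c = walshRow H x c := by
  refine Finset.prod_congr rfl fun i _ => ?_
  split_ifs with hi
  · exact h i hi c
  · rfl

/-- Splitting off the leading binary digit of `y` exhibits the sum as the inner product of two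
different rows. -/
theorem IsWalshBelow.sum_walshRow {k : ℕ} (h : IsWalshBelow k H) {y : Fin 16} {i : Fin 4}
    {y' : Fin 16} (hy : bitRow i ^^^ y' = y) (hne : bitRow i ≠ y') (hk : y'.val < k) :
    ∑ c, walshRow H y c = 0 := by
  rw [← h.isHadamard.row_orthogonal hne]
  refine Finset.sum_congr rfl fun c _ => ?_
  rw [← walshRow_mul_walshRow h.isHadamard hy, walshRow_bitRow, h.row_eq y' hk]

/-- The rows with the numbers `1`, `2`, `4`, `8` are arbitrary; any other row with the number `k`
can be made equal to the product prescribed by binary expansion, by switching and a row permutation. -/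
theorem IsWalshBelow.exists_succ (k : Fin 16) (hk : k ≠ 0) (h : IsWalshBelow k H) :
    ∃ K, ReflTransGen RowSwitchStep H K ∧ IsWalshBelow (k + 1) K := by
  by_cases hpow : ∃ i, bitRow i = k
  · obtain ⟨i, rfl⟩ := hpow
    refine ⟨H, .refl, h.isHadamard, fun x hx c => ?_⟩
    rcases Nat.lt_succ_iff_lt_or_eq.1 hx with hx | hx
    · exact h.row_eq x hx c
    · rw [Fin.ext hx, walshRow_bitRow]
  · have hH := h.isHadamard
    have hsplit : ∀ k : Fin 16, k ≠ 0 → (¬∃ i, bitRow i = k) →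
        ∃ i k', bitRow i ^^^ k' = k ∧ k' ≠ 0 ∧ k' < bitRow i ∧ bitRow i < k := by decide +kernel
    -- the leading binary digit of `k ^^^ x` does not exceed that of `k`
    have hlead : ∀ k x : Fin 16, x < k →
        ∃ i y, bitRow i ^^^ y = k ^^^ x ∧ bitRow i ≠ y ∧ y < k := by decide +kernel
    have hbits : ∀ (x : Fin 16) (i : Fin 4), x.val.testBit i → bitRow i ≤ x := by decide
    obtain ⟨i, k', hik, hk', hlt, hlt'⟩ := hsplit k hk hpow
    have hw := walshRow_entry hH k
    -- `walshRow H k` is the triple product of the rows `0`, `k'` and `bitRow i`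
    have h8 : ∀ r, 8 ∣ ∑ c, walshRow H k c * H r c := by
      intro r
      convert hH.eight_dvd_inner (a := 0) (b := k') (d := bitRow i) hk'.symm
        (fun h0 => by rw [← h0] at hlt; exact absurd hlt (by simp)) hlt.ne r using 2 with c
      rw [h.row_eq 0 (Fin.pos_iff_ne_zero.2 hk) c, walshRow_zero, one_mul, ← walshRow_bitRow H i c,
        h.row_eq k' (hlt.trans hlt') c, mul_comm (walshRow H k' c),
        walshRow_mul_walshRow hH hik]
    have horth : ∀ x, x < k → ∑ c, walshRow H k c * H x c = 0 := by
      intro x hx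
      obtain ⟨j, y, hy, hne, hyk⟩ := hlead k x hx
      rw [← h.sum_walshRow hy hne hyk]
      exact Finset.sum_congr rfl fun c _ => by
        rw [h.row_eq x hx, walshRow_mul_walshRow hH rfl]
    obtain ⟨K, hHK, hK, ⟨p, e, he, hp, hpe⟩, hfix⟩ := exists_rowSwitch_row_eq hH hw h8
    have hkp : k ≤ p := by
      by_contra hlt
      exact hp (horth p (not_le.1 hlt))
    set K₁ := K.submatrix (Equiv.swap k p) id with hK₁
    set L : Matrix (Fin 16) (Fin 16) ℤ :=
      Matrix.of fun r c => (if r = k then e else 1) * K₁ r c with hL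
    have hLk : ∀ c, L k c = walshRow H k c := by
      intro c
      simp only [hL, hK₁, of_apply, if_true, submatrix_apply, Equiv.swap_apply_left, id, hpe]
      rcases he with h | h <;> simp [h]
    have hLx : ∀ x, x < k → ∀ c, L x c = H x c := by
      intro x hx c
      simp only [hL, hK₁, of_apply, if_neg hx.ne, submatrix_apply, id, one_mul,
        Equiv.swap_apply_of_ne_of_ne hx.ne (hx.trans_le hkp).ne]
      exact hfix x (horth x hx) c
    have hKL : ReflTransGen HStep K L := by
      refine .head (.permuteRows K (Equiv.swap k p)) (reflTransGen_hStep_negRows K₁ _ fun r => ?_)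
      split_ifs
      · exact he
      · exact .inl rfl
    refine ⟨L, hHK.trans (hKL.lift id .hadamard), isHadamard_of_reflTransGen_hStep hK hKL,
      fun x hx c => ?_⟩
    · rcases Nat.lt_succ_iff_lt_or_eq.1 hx with hx | hx
      · rw [hLx x hx, h.row_eq x hx]
        exact (walshRow_congr (fun i hi => hLx _ ((hbits x i hi).trans_lt hx)) c).symm
      · obtain rfl : x = k := Fin.ext hx
        rw [hLk]
        refine (walshRow_congr (fun i hi => hLx _ ?_) c).symm
        exact lt_of_le_of_ne (hbits x i hi) fun h => hpow ⟨i, h⟩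

end Walsh

theorem sylvester_succ (k : ℕ) : sylvester (k + 1) =
    Matrix.reindex (finCongr (by ring)) (finCongr (by ring))
      (block (sylvester k) (sylvester k) (sylvester k) (-sylvester k)) := rfl

theorem isHadamard_sylvester (k : ℕ) : (sylvester k).IsHadamard := by
  induction k with
  | zero =>
    change (1 : Matrix (Fin 1) (Fin 1) ℤ).IsHadamard
    exact ⟨by simp, by simp, by simp⟩
  | succ k ih => exact (isHadamard_block ih ih).reindex _ _

theorem transpose_sylvester (k : ℕ) : (sylvester k)ᵀ = sylvester k := by
  induction k with
  | zero => exact transpose_one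
  | succ k ih =>
    rw [sylvester_succ, transpose_reindex, transpose_block, transpose_neg, ih]

theorem isWalshBelow_sylvester : IsWalshBelow 16 (sylvester 4) := by
  have h : sylvester 4 = Matrix.of (walshRow (sylvester 4)) := by decide +kernel
  exact ⟨isHadamard_sylvester 4, fun x _ c => congrFun (congrFun h x) c⟩

/-- The sequence of the entries of a column in the rows with the numbers `1`, `2`, `4`, `8`, read as
four truth values. -/
def columnBits (H : Matrix (Fin 16) (Fin 16) ℤ) (c : Fin 16) (i : Fin 4) : Bool :=
  decide (H (bitRow i) c = 1)

theorem IsWalshBelow.bijective_columnBits {H : Matrix (Fin 16) (Fin 16) ℤ}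
    (h : IsWalshBelow 16 H) : Function.Bijective (columnBits H) := by
  rw [Fintype.bijective_iff_injective_and_card]
  refine ⟨fun c d hcd => ?_, by simp⟩
  have hbit : ∀ i, H (bitRow i) c = H (bitRow i) d := by
    intro i
    have := congrFun hcd i
    rcases h.isHadamard.entry (bitRow i) c with h1 | h1 <;>
      rcases h.isHadamard.entry (bitRow i) d with h2 | h2 <;> simp [columnBits, h1, h2] at this ⊢
  have hcol : ∀ r, H r c = H r d := by
    intro r
    rw [h.row_eq r r.2, h.row_eq r r.2]
    simp only [walshRow, hbit]
  by_contra hne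
  have := h.isHadamard.col_inner c d
  simp [hcol, h.isHadamard.entry_mul_self, hne] at this

theorem IsWalshBelow.exists_permuteCols {H K : Matrix (Fin 16) (Fin 16) ℤ}
    (hH : IsWalshBelow 16 H) (hK : IsWalshBelow 16 K) :
    ∃ σ : Equiv.Perm (Fin 16), K = H.submatrix id σ := by
  let eH := Equiv.ofBijective _ hH.bijective_columnBits
  let eK := Equiv.ofBijective _ hK.bijective_columnBits
  refine ⟨eK.trans eH.symm, ?_⟩
  ext r c
  have hbits : columnBits H (eK.trans eH.symm c) = columnBits K c := eH.apply_symm_apply (eK c)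
  have hbit : ∀ i, H (bitRow i) (eK.trans eH.symm c) = K (bitRow i) c := by
    intro i
    have := congrFun hbits i
    rcases hH.isHadamard.entry (bitRow i) (eK.trans eH.symm c) with h1 | h1 <;>
      rcases hK.isHadamard.entry (bitRow i) c with h2 | h2 <;>
      simp only [columnBits, h1, h2] at this ⊢ <;> simp at this
  rw [submatrix_apply, id, hH.row_eq r r.2, hK.row_eq r r.2]
  simp only [walshRow, hbit]

/-- Every Hadamard matrix of order 16 is transformed into the Sylvester matrix by switching
quadruples of rows only. -/
theorem reflTransGen_rowSwitchStep_sylvester {A : Matrix (Fin 16) (Fin 16) ℤ}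
    (hA : A.IsHadamard) : ReflTransGen RowSwitchStep A (sylvester 4) := by
  have key : ∀ k : ℕ, k < 16 →
      ∃ K, ReflTransGen RowSwitchStep A K ∧ IsWalshBelow (k + 1) K := by
    intro k
    induction k with
    | zero =>
      intro _
      have h := reflTransGen_hStep_negCols A (A 0) (hA.entry 0)
      refine ⟨_, ReflTransGen.mono .hadamard _ _ h, isHadamard_of_reflTransGen_hStep hA h,
        fun x hx c => ?_⟩
      · obtain rfl : x = 0 := Fin.ext (by simpa using hx)
        rw [of_apply, hA.entry_mul_self, walshRow_zero]
    | succ k ih =>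
      intro hk
      obtain ⟨K, hAK, hK⟩ := ih (by omega)
      obtain ⟨L, hKL, hL⟩ := IsWalshBelow.exists_succ (⟨k + 1, hk⟩ : Fin 16)
        (by simp [Fin.ext_iff]) hK
      exact ⟨L, hAK.trans hKL, hL⟩
  obtain ⟨K, hAK, hK⟩ := key 15 (by norm_num)
  obtain ⟨σ, hσ⟩ := hK.exists_permuteCols isWalshBelow_sylvester
  rw [hσ]
  exact hAK.tail (.hadamard _ _ (.permuteCols K σ))

/-! ### Order 32 -/

theorem reflTransGen_qStep_sylvester {A B : Matrix (Fin 16) (Fin 16) ℤ} (hA : A.IsHadamard)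
    (hB : B.IsHadamard) : ReflTransGen QStep (block A A B (-B)) (sylvester 5) := by
  have hS := isHadamard_sylvester 4
  have h1 := reflTransGen_qStep_block hA.entry hB.entry (reflTransGen_rowSwitchStep_sylvester hA)
  have h2 := reflTransGen_qStep_block_swap (sylvester 4) B
  have h3 := reflTransGen_qStep_block hB.entry hS.entry (reflTransGen_rowSwitchStep_sylvester hB)
  exact (h1.trans h2).trans h3

theorem qEquiv_sylvester {H : Matrix (Fin 32) (Fin 32) ℤ} (hH : H ∈ doubledHadamard 16) :
    QEquiv H (sylvester 5) := by
  obtain ⟨A, B, hA, hB, rfl | rfl⟩ := hH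
  -- the first form is the transpose of the second one
  · have ht : block A B A (-B) = (block Aᵀ Aᵀ Bᵀ (-Bᵀ))ᵀ := (transpose_block ..).symm
    rw [ht]
    refine ⟨(isHadamard_block hA.transpose hB.transpose).transpose, isHadamard_sylvester 5, ?_⟩
    have := reflTransGen_qStep_transpose (reflTransGen_qStep_sylvester hA.transpose hB.transpose)
    rwa [transpose_sylvester] at this
  · exact ⟨isHadamard_block hA hB, isHadamard_sylvester 5, reflTransGen_qStep_sylvester hA hB⟩

theorem mainTheorem7 :
    (∀ H K : Matrix (Fin 32) (Fin 32) ℤ,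
      H ∈ doubledHadamard 16 → K ∈ doubledHadamard 16 → QEquiv H K) ∧
    (∀ H : Matrix (Fin 32) (Fin 32) ℤ,
      H ∈ doubledHadamard 16 → HClass H ⊆ QClass (sylvester 5)) := by
  refine ⟨fun H K hH hK => ?_, fun H hH K hK => ?_⟩
  · obtain ⟨h1, -, h⟩ := qEquiv_sylvester hH
    obtain ⟨h2, -, h'⟩ := qEquiv_sylvester hK
    exact ⟨h1, h2, h.trans (reflTransGen_qStep_symm h')⟩
  · obtain ⟨-, hS, h⟩ := qEquiv_sylvester hH
    exact ⟨hS, hK.2.1, (reflTransGen_qStep_symm h).trans (hK.2.2.lift id .hadamard)⟩
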